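/- Let $\Sigma$ be a finite alphabet. Timed words over $\Sigma$ are finite or infinite sequences $\rho=(\sigma_1,\tau_1)(\sigma_2,\tau_2)\cdots$ with $\sigma_i\in\Sigma$, $\tau_i\in\mathbb R_{\ge 0}$ and $\tau_1\le\tau_2\le\cdots$, where $\tau_i\to\infty$ if $\rho$ is infinite. All intervals below have endpoints in $\mathbb Z_{\ge 0}\cup\{\infty\}$, and each endpoint may be included or excluded. MTL formulas are $\varphi::=a\mid\top\mid\varphi\wedge\varphi\mid\neg\varphi\mid\varphi\,\mathsf U_I\,\varphi$ with $a\in\Sigma$ and $I$ an interval, under the pointwise semantics: $\rho,i\models\varphi_1\mathsf U_I\varphi_2$ iff there is a position $j>i$ with $\rho,j\models\varphi_2$, $\tau_j-\tau_i\in I$, and $\rho,k\models\varphi_1$ for all $i<k<j$. MITL consists of the MTL formulas in which no interval is of the form $[c,c]$. 1-TPTL formulas use a single freeze variable $x$: $\psi::=a\mid\neg a\mid\top\mid\bot\mid x.\psi\mid x\in I\mid\psi\wedge\psi\mid\psi\vee\psi\mid\psi\,\mathsf U\,\psi\mid\mathsf G\,\psi$. They are evaluated at a position $i$ under a value $\nu\ge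 0$ of $x$: $x.\psi$ holds iff $\psi$ holds at $i$ with $\nu$ replaced by $\tau_i$; $x\in I$ holds iff $\tau_i-\nu\in I$; $\psi_1\mathsf U\psi_2$ holds iff $\psi_2$ holds at some $j>i$ and $\psi_1$ at all $i<k<j$; $\mathsf G\psi$ holds iff $\psi$ holds at all $j>i$; $\mathsf F\psi=\top\,\mathsf U\,\psi$. A constraint $x\in I$ is open in a formula if it is not in the scope of a quantifier $x.$ in that formula; a formula is closed if it has no open constraint. The fragment 1-$\mathrm{TPTL}^{0,\infty}$ consists of the formulas each of whose subformulas $\chi$ satisfies one of the following: all intervals in open constraints of $\chi$ have lower endpoint $0$ and a finite upper endpoint $u\in\mathbb Z_{\ge0}$; or all of them have upper endpoint $\infty$. The language of an MTL formula, or of a closed 1-TPTL formula, is the set of nonempty timed words whose first position satisfies it. Theorem (1-$\mathrm{TPTL}^{0,\infty}$ is strictly more expressive than MITL). (1) For every MITL formula $\varphi$ there is a closed 1-$\mathrm{TPTL}^{0,\infty}$ formula $\psi$ that is equivalent to $\varphi$: for every finite or infinite timed word $\rho$, every position $i$ of $\rho$ and every value $\nu$ of $x$, $\rho,i,\nu\models\psi$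 iff $\rho,i\models\varphi$. (2) For every $b\in\Sigma$, the formula $\beta=x.\mathsf F(b\wedge\mathsf F(b\wedge x\le 1))$ is a closed 1-$\mathrm{TPTL}^{0,\infty}$ formula, but no MTL formula (hence no MITL formula) has the same language as $\beta$, neither over finite timed words nor over infinite timed words. -/

import Mathlib

open scoped NNReal

namespace TimedLogic

/-- An interval of real numbers with end points in `ℕ ∪ {0, ∞}`, each end point being either
included or excluded.  (An infinite upper end point is never attained, so `rightClosed` is
irrelevant when `upper = ⊤`.) -/
structure Interval where
  lower : ℕ
  upper : ℕ∞
  leftClosed : Bool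
  rightClosed : Bool

namespace Interval

/-- The set of real numbers denoted by an interval. -/
def toSet (I : Interval) : Set ℝ :=
  {t | (if I.leftClosed then (I.lower : ℝ) ≤ t else (I.lower : ℝ) < t) ∧
    ∀ u : ℕ, I.upper = u → if I.rightClosed then t ≤ (u : ℝ) else t < (u : ℝ)}

/-- Punctual intervals are those of the form `[x, x]`. -/
def IsPunctual (I : Interval) : Prop :=
  I.leftClosed = true ∧ I.rightClosed = true ∧ I.upper = I.lower

/-- Intervals `⟨0, u⟩` with `u` a non-negative integer. -/
def IsRightSided (I : Interval) : Prop :=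
  I.lower = 0 ∧ I.upper ≠ ⊤

/-- Intervals `⟨l, ∞)` with `l` a non-negative integer. -/
def IsLeftSided (I : Interval) : Prop :=
  I.upper = ⊤

end Interval

/-- The positions of a word of length `n ∈ ℕ ∪ {∞}` (numbered from `0`). -/
abbrev Position (n : ℕ∞) : Type := {i : ℕ // (i : ℕ∞) < n}

/-- Finite and infinite timed words over `A`: time stamps are non-negative reals and weakly
increase along the word; in an infinite word they tend to infinity. -/
structure TimedWord (A : Type*) where
  length : ℕ∞
  letter : Position length → A
  time : Position length → ℝ≥0
  mono : Monotone time
  nonZeno : length = ⊤ → ∀ T : ℝ≥0, ∃ i, T < time i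

namespace TimedWord

variable {A : Type*}

/-- The domain of a timed word. -/
abbrev Dom (ρ : TimedWord A) : Type := Position ρ.length

def IsFinite (ρ : TimedWord A) : Prop := ρ.length ≠ ⊤

def IsInfinite (ρ : TimedWord A) : Prop := ρ.length = ⊤

end TimedWord

/-- Formulas of Metric Temporal Logic over the alphabet `A`. -/
inductive MTL (A : Type*) where
  | atom (a : A) : MTL A
  | top : MTL A
  | and (φ ψ : MTL A) : MTL A
  | not (φ : MTL A) : MTL A
  | untl (I : Interval) (φ ψ : MTL A) : MTL A

namespace MTL

variable {A : Type*}

/-- Pointwise semantics of MTL, with the strict until. -/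
def Sat (ρ : TimedWord A) : MTL A → ρ.Dom → Prop
  | atom a, i => ρ.letter i = a
  | top, _ => True
  | and φ ψ, i => φ.Sat ρ i ∧ ψ.Sat ρ i
  | not φ, i => ¬ φ.Sat ρ i
  | untl I φ ψ, i => ∃ j, i < j ∧ ψ.Sat ρ j ∧ (ρ.time j : ℝ) - (ρ.time i : ℝ) ∈ I.toSet ∧
      ∀ k, i < k → k < j → φ.Sat ρ k

/-- MITL: the MTL formulas all of whose intervals are non-punctual. -/
def IsMITL : MTL A → Prop
  | atom _ => True
  | top => True
  | and φ ψ => φ.IsMITL ∧ ψ.IsMITL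
  | not φ => φ.IsMITL
  | untl I φ ψ => ¬ I.IsPunctual ∧ φ.IsMITL ∧ ψ.IsMITL

/-- The timed words whose first position satisfies the formula. -/
def language (φ : MTL A) : Set (TimedWord A) :=
  {ρ | ∃ i : ρ.Dom, i.1 = 0 ∧ φ.Sat ρ i}

end MTL

/-- Formulas of Timed Propositional Temporal Logic, in negation normal form, over the alphabet
`A` and with freeze variables in `X`. -/
inductive TPTL (A X : Type*) where
  | atom (a : A) : TPTL A X
  | natom (a : A) : TPTL A X
  | top : TPTL A X
  | bot : TPTL A X
  /-- The freeze quantifier `x.φ`. -/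
  | freeze (x : X) (φ : TPTL A X) : TPTL A X
  /-- The constraint `T - x ∈ I`. -/
  | constr (x : X) (I : Interval) : TPTL A X
  | and (φ ψ : TPTL A X) : TPTL A X
  | or (φ ψ : TPTL A X) : TPTL A X
  | untl (φ ψ : TPTL A X) : TPTL A X
  | globally (φ : TPTL A X) : TPTL A X

namespace TPTL

variable {A X : Type*}

/-- `F φ = ⊤ U φ`. -/
def eventually (φ : TPTL A X) : TPTL A X := untl top φ

/-- Pointwise semantics of TPTL at a position, under a valuation of the freeze variables. -/
def Sat [DecidableEq X] (ρ : TimedWord A) : TPTL A X → ρ.Dom → (X → ℝ≥0) → Prop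
  | atom a, i, _ => ρ.letter i = a
  | natom a, i, _ => ρ.letter i ≠ a
  | top, _, _ => True
  | bot, _, _ => False
  | freeze x φ, i, ν => φ.Sat ρ i (Function.update ν x (ρ.time i))
  | constr x I, i, ν => (ρ.time i : ℝ) - (ν x : ℝ) ∈ I.toSet
  | and φ ψ, i, ν => φ.Sat ρ i ν ∧ ψ.Sat ρ i ν
  | or φ ψ, i, ν => φ.Sat ρ i ν ∨ ψ.Sat ρ i ν
  | untl φ ψ, i, ν => ∃ j, i < j ∧ ψ.Sat ρ j ν ∧ ∀ k, i < k → k < j → φ.Sat ρ k ν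
  | globally φ, i, ν => ∀ j, i < j → φ.Sat ρ j ν

/-- The constraints `T - x ∈ I` of a formula that are not in the scope of a quantifier `x.`. -/
def openConstraints : TPTL A X → Set (X × Interval)
  | atom _ => ∅
  | natom _ => ∅
  | top => ∅
  | bot => ∅
  | freeze x φ => {c | c ∈ φ.openConstraints ∧ c.1 ≠ x}
  | constr x I => {(x, I)}
  | and φ ψ => φ.openConstraints ∪ ψ.openConstraints
  | or φ ψ => φ.openConstraints ∪ ψ.openConstraints
  | untl φ ψ => φ.openConstraints ∪ ψ.openConstraints
  | globally φ => φ.openConstraints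

/-- A formula is closed if it has no open constraint. -/
def IsClosed (φ : TPTL A X) : Prop := φ.openConstraints = ∅

/-- The subformulas of a formula, including the formula itself. -/
def subformulas : TPTL A X → Set (TPTL A X)
  | atom a => {atom a}
  | natom a => {natom a}
  | top => {top}
  | bot => {bot}
  | freeze x φ => insert (freeze x φ) φ.subformulas
  | constr x I => {constr x I}
  | and φ ψ => insert (and φ ψ) (φ.subformulas ∪ ψ.subformulas)
  | or φ ψ => insert (or φ ψ) (φ.subformulas ∪ ψ.subformulas)
  | untl φ ψ => insert (untl φ ψ) (φ.subformulas ∪ ψ.subformulas)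
  | globally φ => insert (globally φ) φ.subformulas

/-- Type `≤`: every open constraint uses an interval `⟨0, u⟩`. -/
def IsTypeLE (φ : TPTL A X) : Prop := ∀ c ∈ φ.openConstraints, c.2.IsRightSided

/-- Type `≥`: every open constraint uses an interval `⟨l, ∞)`. -/
def IsTypeGE (φ : TPTL A X) : Prop := ∀ c ∈ φ.openConstraints, c.2.IsLeftSided

/-- The fragment `TPTL^{0,∞}`: every subformula is of type `≤` or of type `≥`. -/
def IsUnilateral (φ : TPTL A X) : Prop := ∀ ψ ∈ φ.subformulas, ψ.IsTypeLE ∨ ψ.IsTypeGE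

/-- The timed words whose first position satisfies the formula.  (All variables are initially `0`;
for closed formulas the initial valuation is irrelevant.) -/
def language [DecidableEq X] (φ : TPTL A X) : Set (TimedWord A) :=
  {ρ | ∃ i : ρ.Dom, i.1 = 0 ∧ φ.Sat ρ i (fun _ => 0)}

/-- The one-variable formula `x.F(b ∧ F(b ∧ x ≤ 1))`. -/
def twiceWithinOne (b : A) : TPTL A (Fin 1) :=
  freeze 0 (eventually (and (atom b)
    (eventually (and (atom b)
      (constr 0 { lower := 0, upper := 1, leftClosed := true, rightClosed := true })))))

end TPTL

end TimedLogic

/-!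
Translating MITL into unilateral formulas. The only difficulty is `P U_I Q` with a bounded
interval `I = ⟨l, u⟩`, `l < u`, since a single formula may not mix the constraints `x ∈ [0, u⟩` and
`x ∈ ⟨l, ∞)`. Call a position satisfying `Q` isolated if `P U Q` has no witness less than one time
unit ahead of it; this is a closed unilateral property. Isolated witnesses of one until are at
least one time unit apart (`Chain.le_time`), so at most `u` of them precede a witness in the window.
Between two consecutive isolated witnesses, successive witnesses are less than one time unit apart
and cannot jump over a window of length at least one (`exists_witness_of_early`). Hence `P U_I Q`
holds iff for some `m ≤ u` there are, among the witnesses preceded by exactly `m` isolated ones, one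
with `x ∈ [0, u⟩` and one with `x ∈ ⟨l, ∞)`, not necessarily the same
(`until_iff_exists_chain`). The two conditions are stated under separate freeze quantifiers. As the
target logic is in negation normal form, a property is carried along with its negation
(`BiExpressible`); negation exchanges the two kinds of one-sided constraints.

MTL cannot express `x.F(b ∧ F(b ∧ x ≤ 1))`. Consider words consisting of letters `b` only, with time
stamps `q, s, 2s, 3s, …`, where `s = √2 / 2` and `q` is rational, `0 ≤ q ≤ 1/2`. All time differences
are non-integers, and consecutive events are less than one time unit apart. So an
interval containing some `(l, l + 1)` is met from every position with enough events ahead, and any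
other interval, being empty or a single integer, is met from none. Consequently the truth value of
an MTL formula is the same at all positions, and for all `q`, if the word is infinite
(`exists_forall_sat_stepWord_top_iff`), and becomes so sufficiently far from the end if it is finite
(`exists_forall_sat_stepWord_iff`). But `2s - q ≤ 1` holds for `q = 1/2` and fails for `q = 0`.
-/

namespace TimedLogic

variable {A : Type*}

/-! ### Properties expressible with one-sided clock constraints -/

/-- A property of the positions of timed words that may depend on the value of the clock. -/
abbrev ClockProp (A : Type*) : Type _ := ∀ ρ : TimedWord A, ρ.Dom → ℝ≥0 → Prop

/-- The intervals allowed on a side: `⟨0, u⟩` for `true` and `⟨l, ∞)` for `false`. -/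
def OneSided : Bool → Interval → Prop
  | true => Interval.IsRightSided
  | false => Interval.IsLeftSided

/-- `Q` is defined by a unilateral formula whose open constraints all lie on side `s`. Only clock
values in the past of the evaluation position matter: the others do not arise under a freeze
quantifier, and excluding them makes `[0, l)` the complement of `[l, ∞)`. -/
def Expressible (s : Bool) (Q : ClockProp A) : Prop :=
  ∃ ψ : TPTL A (Fin 1), ψ.IsUnilateral ∧ (∀ c ∈ ψ.openConstraints, OneSided s c.2) ∧
    ∀ (ρ : TimedWord A) (i : ρ.Dom) (ν : Fin 1 → ℝ≥0), ν 0 ≤ ρ.time i →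
      (ψ.Sat ρ i ν ↔ Q ρ i (ν 0))

/-- `P` is defined by a closed unilateral formula. -/
def ClosedExpressible (P : ∀ ρ : TimedWord A, ρ.Dom → Prop) : Prop :=
  ∃ ψ : TPTL A (Fin 1), ψ.IsClosed ∧ ψ.IsUnilateral ∧
    ∀ (ρ : TimedWord A) (i : ρ.Dom) (ν : Fin 1 → ℝ≥0), ψ.Sat ρ i ν ↔ P ρ i

/-- Strict until, as an operation on properties. -/
def untilProp (P Q : ClockProp A) : ClockProp A := fun ρ i t =>
  ∃ j, i < j ∧ Q ρ j t ∧ ∀ k, i < k → k < j → P ρ k t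

theorem typeLE_or_typeGE {s : Bool} {ψ : TPTL A (Fin 1)}
    (h : ∀ c ∈ ψ.openConstraints, OneSided s c.2) : ψ.IsTypeLE ∨ ψ.IsTypeGE := by
  cases s
  · exact Or.inr h
  · exact Or.inl h

namespace Expressible

variable {s : Bool} {P Q : ClockProp A}

theorem congr (hP : Expressible s P) (h : ∀ ρ i t, t ≤ ρ.time i → (P ρ i t ↔ Q ρ i t)) :
    Expressible s Q := by
  obtain ⟨ψ, h1, h2, h3⟩ := hP
  exact ⟨ψ, h1, h2, fun ρ i ν hν => (h3 ρ i ν hν).trans (h ρ i _ hν)⟩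

theorem atom (a : A) : Expressible s fun ρ i _ => ρ.letter i = a :=
  ⟨.atom a, by simp [TPTL.IsUnilateral, TPTL.subformulas, TPTL.IsTypeLE, TPTL.openConstraints],
    by simp [TPTL.openConstraints], by simp [TPTL.Sat]⟩

theorem natom (a : A) : Expressible s fun ρ i _ => ρ.letter i ≠ a :=
  ⟨.natom a, by simp [TPTL.IsUnilateral, TPTL.subformulas, TPTL.IsTypeLE, TPTL.openConstraints],
    by simp [TPTL.openConstraints], by simp [TPTL.Sat]⟩

theorem top : Expressible (A := A) s fun _ _ _ => True :=
  ⟨.top, by simp [TPTL.IsUnilateral, TPTL.subformulas, TPTL.IsTypeLE, TPTL.openConstraints],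
    by simp [TPTL.openConstraints], by simp [TPTL.Sat]⟩

theorem bot : Expressible (A := A) s fun _ _ _ => False :=
  ⟨.bot, by simp [TPTL.IsUnilateral, TPTL.subformulas, TPTL.IsTypeLE, TPTL.openConstraints],
    by simp [TPTL.openConstraints], by simp [TPTL.Sat]⟩

theorem constr {I : Interval} (hI : OneSided s I) :
    Expressible (A := A) s fun ρ i t => (ρ.time i : ℝ) - t ∈ I.toSet := by
  have h : ∀ c ∈ (TPTL.constr (A := A) (0 : Fin 1) I).openConstraints, OneSided s c.2 := by
    simpa [TPTL.openConstraints] using hI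
  refine ⟨.constr 0 I, ?_, h, by simp [TPTL.Sat]⟩
  intro χ hχ
  rw [Set.mem_singleton_iff.1 hχ]
  exact typeLE_or_typeGE h

theorem and (hP : Expressible s P) (hQ : Expressible s Q) :
    Expressible s fun ρ i t => P ρ i t ∧ Q ρ i t := by
  obtain ⟨φ, h1, h2, h3⟩ := hP
  obtain ⟨ψ, k1, k2, k3⟩ := hQ
  have h : ∀ c ∈ (φ.and ψ).openConstraints, OneSided s c.2 := by
    rintro c (hc | hc)
    exacts [h2 c hc, k2 c hc]
  refine ⟨φ.and ψ, ?_, h, fun ρ i ν hν => and_congr (h3 ρ i ν hν) (k3 ρ i ν hν)⟩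
  rintro χ (rfl | hχ | hχ)
  exacts [typeLE_or_typeGE h, h1 χ hχ, k1 χ hχ]

theorem or (hP : Expressible s P) (hQ : Expressible s Q) :
    Expressible s fun ρ i t => P ρ i t ∨ Q ρ i t := by
  obtain ⟨φ, h1, h2, h3⟩ := hP
  obtain ⟨ψ, k1, k2, k3⟩ := hQ
  have h : ∀ c ∈ (φ.or ψ).openConstraints, OneSided s c.2 := by
    rintro c (hc | hc)
    exacts [h2 c hc, k2 c hc]
  refine ⟨φ.or ψ, ?_, h, fun ρ i ν hν => or_congr (h3 ρ i ν hν) (k3 ρ i ν hν)⟩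
  rintro χ (rfl | hχ | hχ)
  exacts [typeLE_or_typeGE h, h1 χ hχ, k1 χ hχ]

theorem untl (hP : Expressible s P) (hQ : Expressible s Q) :
    Expressible s (untilProp P Q) := by
  obtain ⟨φ, h1, h2, h3⟩ := hP
  obtain ⟨ψ, k1, k2, k3⟩ := hQ
  have h : ∀ c ∈ (φ.untl ψ).openConstraints, OneSided s c.2 := by
    rintro c (hc | hc)
    exacts [h2 c hc, k2 c hc]
  refine ⟨φ.untl ψ, ?_, h, fun ρ i ν hν => exists_congr fun j => and_congr_right fun hij =>
    and_congr (k3 ρ j ν (hν.trans (ρ.mono hij.le))) (forall_congr' fun k =>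
      imp_congr_right fun hik => imp_congr_right fun _ => h3 ρ k ν (hν.trans (ρ.mono hik.le)))⟩
  rintro χ (rfl | hχ | hχ)
  exacts [typeLE_or_typeGE h, h1 χ hχ, k1 χ hχ]

theorem globally (hP : Expressible s P) :
    Expressible s fun ρ i t => ∀ j, i < j → P ρ j t := by
  obtain ⟨φ, h1, h2, h3⟩ := hP
  refine ⟨φ.globally, ?_, h2, fun ρ i ν hν => forall_congr' fun j =>
    imp_congr_right fun hij => h3 ρ j ν (hν.trans (ρ.mono hij.le))⟩
  rintro χ (rfl | hχ)
  exacts [typeLE_or_typeGE (s := s) h2, h1 χ hχ]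

theorem freeze (hP : Expressible s P) : ClosedExpressible fun ρ i => P ρ i (ρ.time i) := by
  obtain ⟨φ, h1, h2, h3⟩ := hP
  have h : (TPTL.freeze 0 φ).IsClosed :=
    Set.eq_empty_of_forall_notMem fun c hc => hc.2 (Subsingleton.elim _ _)
  refine ⟨φ.freeze 0, h, ?_, fun ρ i ν => ?_⟩
  · rintro χ (rfl | hχ)
    · exact Or.inl fun c hc => (h.subset hc).elim
    · exact h1 χ hχ
  · simpa [TPTL.Sat] using h3 ρ i (Function.update ν 0 (ρ.time i)) (by simp)

end Expressible

theorem ClosedExpressible.expressible {P : ∀ ρ : TimedWord A, ρ.Dom → Prop}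
    (h : ClosedExpressible P) (s : Bool) : Expressible s fun ρ i _ => P ρ i := by
  obtain ⟨ψ, h1, h2, h3⟩ := h
  exact ⟨ψ, h2, fun c hc => (h1.subset hc).elim, fun ρ i ν _ => h3 ρ i ν⟩

/-- `Q` is expressible on side `s` and its negation on the opposite side. Formulas being in
negation normal form, this is the notion that is preserved by all connectives. -/
def BiExpressible (s : Bool) (Q : ClockProp A) : Prop :=
  Expressible s Q ∧ Expressible (!s) fun ρ i t => ¬ Q ρ i t

/-- `P` and its negation are expressible by closed formulas. -/
def ClosedBiExpressible (P : ∀ ρ : TimedWord A, ρ.Dom → Prop) : Prop :=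
  ClosedExpressible P ∧ ClosedExpressible fun ρ i => ¬ P ρ i

theorem not_untilProp_iff (P Q : ClockProp A) (ρ : TimedWord A) (i : ρ.Dom) (t : ℝ≥0) :
    ¬ untilProp P Q ρ i t ↔ (∀ j, i < j → ¬ Q ρ j t) ∨
      untilProp (fun ρ i t => ¬ Q ρ i t) (fun ρ i t => ¬ P ρ i t ∧ ¬ Q ρ i t) ρ i t := by
  constructor
  · intro h
    by_contra! hc
    obtain ⟨⟨j, hij, hj⟩, hU⟩ := hc
    obtain ⟨m, ⟨him, hm⟩, hmin⟩ := WellFounded.has_min (wellFounded_lt (α := ρ.Dom))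
      {j | i < j ∧ Q ρ j t} ⟨j, hij, hj⟩
    refine h ⟨m, him, hm, fun k hik hkm => ?_⟩
    by_contra hk
    exact hU ⟨k, hik, ⟨hk, fun hQ => hmin k ⟨hik, hQ⟩ hkm⟩,
      fun l hil hlk hQ => hmin l ⟨hil, hQ⟩ (hlk.trans hkm)⟩
  · rintro (h | ⟨k, hik, ⟨hP, hQ⟩, hk⟩) ⟨j, hij, hj, hj'⟩
    · exact h j hij hj
    · rcases lt_trichotomy j k with hjk | rfl | hkj
      · exact hk j hij hjk hj
      · exact hQ hj
      · exact hP (hj' k hik hkj)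

namespace BiExpressible

variable {s : Bool} {P Q : ClockProp A}

theorem congr (hP : BiExpressible s P) (h : ∀ ρ i t, t ≤ ρ.time i → (P ρ i t ↔ Q ρ i t)) :
    BiExpressible s Q :=
  ⟨hP.1.congr h, hP.2.congr fun ρ i t ht => not_congr (h ρ i t ht)⟩

theorem not (hP : BiExpressible s P) : BiExpressible (!s) fun ρ i t => ¬ P ρ i t :=
  ⟨hP.2, by simpa using hP.1⟩

theorem and (hP : BiExpressible s P) (hQ : BiExpressible s Q) :
    BiExpressible s fun ρ i t => P ρ i t ∧ Q ρ i t :=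
  ⟨hP.1.and hQ.1, (hP.2.or hQ.2).congr fun _ _ _ _ => by tauto⟩

theorem or (hP : BiExpressible s P) (hQ : BiExpressible s Q) :
    BiExpressible s fun ρ i t => P ρ i t ∨ Q ρ i t :=
  ⟨hP.1.or hQ.1, (hP.2.and hQ.2).congr fun _ _ _ _ => by tauto⟩

theorem untl (hP : BiExpressible s P) (hQ : BiExpressible s Q) :
    BiExpressible s (untilProp P Q) :=
  ⟨hP.1.untl hQ.1, (hQ.2.globally.or (hQ.2.untl (hP.2.and hQ.2))).congr
    fun ρ i t _ => (not_untilProp_iff P Q ρ i t).symm⟩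

theorem bot : BiExpressible (A := A) s fun _ _ _ => False :=
  ⟨.bot, by simpa using Expressible.top⟩

theorem freeze (hP : BiExpressible s P) : ClosedBiExpressible fun ρ i => P ρ i (ρ.time i) :=
  ⟨hP.1.freeze, hP.2.freeze⟩

/-- The constraint `x ∈ [0, u⟩`. -/
theorem constr_right (u : ℕ) (r : Bool) : BiExpressible (A := A) true
    fun ρ i t => (ρ.time i : ℝ) - t ∈ Interval.toSet ⟨0, u, true, r⟩ := by
  refine ⟨.constr ⟨rfl, by simp⟩,
    (Expressible.constr (s := false) (I := ⟨u, ⊤, !r, true⟩) rfl).congr fun ρ i t ht => ?_⟩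
  have : (t : ℝ) ≤ ρ.time i := by exact_mod_cast ht
  cases r <;> simp [Interval.toSet, this, lt_sub_iff_add_lt]

/-- The constraint `x ∈ ⟨l, ∞)`. -/
theorem constr_left (l : ℕ) (c : Bool) : BiExpressible (A := A) false
    fun ρ i t => (ρ.time i : ℝ) - t ∈ Interval.toSet ⟨l, ⊤, c, true⟩ := by
  refine ⟨.constr rfl,
    (Expressible.constr (s := true) (I := ⟨0, l, true, !c⟩) ⟨rfl, by simp⟩).congr fun ρ i t ht => ?_⟩
  have : (t : ℝ) ≤ ρ.time i := by exact_mod_cast ht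
  cases c <;> simp [Interval.toSet, this]

end BiExpressible

namespace ClosedBiExpressible

variable {P Q : ∀ ρ : TimedWord A, ρ.Dom → Prop}

theorem lift (h : ClosedBiExpressible P) (s : Bool) : BiExpressible s fun ρ i _ => P ρ i :=
  ⟨h.1.expressible s, h.2.expressible _⟩

theorem congr (h : ClosedBiExpressible P) (hPQ : ∀ ρ i, P ρ i ↔ Q ρ i) :
    ClosedBiExpressible Q := by
  have : P = Q := by funext ρ i; exact propext (hPQ ρ i)
  rwa [← this]

theorem not (h : ClosedBiExpressible P) : ClosedBiExpressible fun ρ i => ¬ P ρ i :=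
  (h.lift true).not.freeze

theorem and (h : ClosedBiExpressible P) (h' : ClosedBiExpressible Q) :
    ClosedBiExpressible fun ρ i => P ρ i ∧ Q ρ i :=
  ((h.lift true).and (h'.lift true)).freeze

theorem bot : ClosedBiExpressible (A := A) fun _ _ => False :=
  (BiExpressible.bot (s := true)).freeze

/-- Bounded disjunction. -/
theorem exists_le {F : ℕ → ∀ ρ : TimedWord A, ρ.Dom → Prop} (h : ∀ m, ClosedBiExpressible (F m))
    (n : ℕ) : ClosedBiExpressible fun ρ i => ∃ m ≤ n, F m ρ i := by
  induction n with
  | zero => exact (h 0).congr (by simp)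
  | succ n ih =>
    refine ((ih.lift true).or ((h (n + 1)).lift true)).freeze.congr fun ρ i => ?_
    constructor
    · rintro (⟨m, hm, h⟩ | h)
      exacts [⟨m, by omega, h⟩, ⟨_, le_rfl, h⟩]
    · rintro ⟨m, hm, h⟩
      rcases hm.lt_or_eq with hm | rfl
      exacts [Or.inl ⟨m, by omega, h⟩, Or.inr h]

end ClosedBiExpressible

/-! ### Chains of until-witnesses -/

section Chain

variable {ρ : TimedWord A} {P Q : ρ.Dom → Prop}

/-- The witness `Q` at `k` is isolated: no witness of `P U Q` lies less than one time unit
ahead. -/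
def Isolated (P Q : ρ.Dom → Prop) (k : ρ.Dom) : Prop :=
  Q k ∧ ¬ ∃ j, k < j ∧ (Q j ∧ (ρ.time j : ℝ) - ρ.time k < 1) ∧ ∀ l, k < l → l < j → P l

/-- `P` holds strictly between `i` and `j`, where there are exactly `m` isolated witnesses. -/
def Chain (P Q : ρ.Dom → Prop) : ℕ → ρ.Dom → ρ.Dom → Prop
  | 0, i, j => i < j ∧ ∀ k, i < k → k < j → P k ∧ ¬ Isolated P Q k
  | m + 1, i, j => ∃ k, i < k ∧ (∀ l, i < l → l < k → P l ∧ ¬ Isolated P Q l) ∧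
      P k ∧ Isolated P Q k ∧ Chain P Q m k j

theorem Chain.lt {m : ℕ} {i j : ρ.Dom} (h : Chain P Q m i j) : i < j := by
  induction m generalizing i with
  | zero => exact h.1
  | succ m ih =>
    obtain ⟨k, hik, -, -, -, hk⟩ := h
    exact hik.trans (ih hk)

theorem Chain.holds {m : ℕ} {i j : ρ.Dom} (h : Chain P Q m i j) :
    ∀ k, i < k → k < j → P k := by
  induction m generalizing i with
  | zero => exact fun k hik hkj => (h.2 k hik hkj).1
  | succ m ih =>
    obtain ⟨k, -, hk, hPk, -, hc⟩ := h
    intro l hil hlj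
    rcases lt_trichotomy l k with hlk | rfl | hkl
    exacts [(hk l hil hlk).1, hPk, ih hc l hkl hlj]

theorem exists_chain {i j : ρ.Dom} (hij : i < j) (hP : ∀ k, i < k → k < j → P k) :
    ∃ m, Chain P Q m i j := by
  induction hn : j.1 - i.1 using Nat.strong_induction_on generalizing i with
  | _ n ih =>
  by_cases h : ∃ k, i < k ∧ k < j ∧ Isolated P Q k
  · obtain ⟨k, ⟨hik, hkj, hk⟩, hmin⟩ := WellFounded.has_min (wellFounded_lt (α := ρ.Dom))
      {k | i < k ∧ k < j ∧ Isolated P Q k} h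
    have h1 : i.1 < k.1 := hik
    have h2 : k.1 < j.1 := hkj
    obtain ⟨m, hm⟩ := ih (j.1 - k.1) (by omega) hkj
      (fun l hkl hlj => hP l (hik.trans hkl) hlj) rfl
    exact ⟨m + 1, k, hik, fun l hil hlk => ⟨hP l hil (hlk.trans hkj),
      fun hl => hmin l ⟨hil, hlk.trans hkj, hl⟩ hlk⟩, hP k hik hkj, hk, hm⟩
  · exact ⟨0, hij, fun k hik hkj => ⟨hP k hik hkj, fun hk => h ⟨k, hik, hkj, hk⟩⟩⟩

theorem Isolated.one_le {k j : ρ.Dom} (hk : Isolated P Q k) (hkj : k < j) (hj : Q j)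
    (hP : ∀ l, k < l → l < j → P l) : 1 ≤ (ρ.time j : ℝ) - ρ.time k := by
  by_contra! h
  exact hk.2 ⟨j, hkj, ⟨hj, h⟩, hP⟩

theorem Chain.add_one_le {m : ℕ} {i j : ρ.Dom} (h : Chain P Q m i j) (hi : Isolated P Q i)
    (hj : Q j) : (m : ℝ) + 1 ≤ (ρ.time j : ℝ) - ρ.time i := by
  induction m generalizing i with
  | zero => simpa using hi.one_le h.lt hj h.holds
  | succ m ih =>
    obtain ⟨k, hik, hk, -, hIk, hc⟩ := h
    have h1 := ih hc hIk
    have h2 := hi.one_le hik hIk.1 fun l hil hlk => (hk l hil hlk).1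
    push_cast
    linarith

/-- Isolated witnesses are at least one time unit apart, so that a chain spans at least as many
time units as it has isolated witnesses. -/
theorem Chain.le_time {m : ℕ} {i j : ρ.Dom} (h : Chain P Q m i j) (hj : Q j) :
    (m : ℝ) ≤ (ρ.time j : ℝ) - ρ.time i := by
  cases m with
  | zero =>
    have : (ρ.time i : ℝ) ≤ ρ.time j := by exact_mod_cast ρ.mono h.lt.le
    simpa using this
  | succ m =>
    obtain ⟨k, hik, -, -, hk, hc⟩ := h
    have h1 := hc.add_one_le hk hj
    have : (ρ.time i : ℝ) ≤ ρ.time k := by exact_mod_cast ρ.mono hik.le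
    push_cast
    linarith

/-- Starting from a witness that is too early, jumps of length less than one through non-isolated
witnesses cannot miss a window of length at least one. -/
theorem exists_witness_of_early {I : Interval} {u : ℕ} (hu : I.upper = u) (hlu : I.lower < u)
    {t : ℝ} {a b : ρ.Dom} (hQa : Q a)
    (hPb : ∀ k, a ≤ k → k < b → ¬ Isolated P Q k)
    (hta : (ρ.time a : ℝ) - t ≤ I.lower) (htb : (u : ℝ) ≤ ρ.time b - t) :
    ∃ w, a < w ∧ w < b ∧ Q w ∧ (ρ.time w : ℝ) - t ∈ I.toSet := by
  induction hn : b.1 - a.1 using Nat.strong_induction_on generalizing a with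
  | _ n ih =>
  have hlu' : (I.lower : ℝ) + 1 ≤ u := by exact_mod_cast hlu
  have lt_b : ∀ w : ρ.Dom, (ρ.time w : ℝ) - t < u → w < b := by
    intro w hw
    by_contra! hbw
    have : (ρ.time b : ℝ) ≤ ρ.time w := by exact_mod_cast ρ.mono hbw
    linarith
  have hab : a < b := lt_b a (by linarith)
  have hna := hPb a le_rfl hab
  simp only [Isolated, hQa, true_and, not_not] at hna
  obtain ⟨w, haw, ⟨hQw, htw⟩, -⟩ := hna
  have htw' : (ρ.time w : ℝ) - t < u := by linarith
  have hwb := lt_b w htw'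
  by_cases hw : (ρ.time w : ℝ) - t ≤ I.lower
  · have h1 : a.1 < w.1 := haw
    have h2 : w.1 < b.1 := hwb
    obtain ⟨v, hwv, hv⟩ := ih (b.1 - w.1) (by omega) hQw
      (fun k hwk hkb => hPb k (haw.le.trans hwk) hkb) hw rfl
    exact ⟨v, haw.trans hwv, hv⟩
  · refine ⟨w, haw, hwb, hQw, ?_, fun u' hu' => ?_⟩
    · split_ifs <;> linarith
    · obtain rfl : u = u' := by rw [hu] at hu'; exact_mod_cast hu'
      split_ifs <;> linarith

/-- An early enough and a late enough witness that are preceded by the same number of isolated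
witnesses give one in the window. -/
theorem Chain.exists_witness {I : Interval} {u : ℕ} (hu : I.upper = u) (hlu : I.lower < u)
    {t : ℝ} {m : ℕ} {i a b : ρ.Dom} (hit : t ≤ ρ.time i) (ha : Chain P Q m i a)
    (hb : Chain P Q m i b) (hQa : Q a) (hQb : Q b)
    (hta : (ρ.time a : ℝ) - t ∈ Interval.toSet ⟨0, u, true, I.rightClosed⟩)
    (htb : (ρ.time b : ℝ) - t ∈ Interval.toSet ⟨I.lower, ⊤, I.leftClosed, true⟩) :
    ∃ w, i < w ∧ Q w ∧ (ρ.time w : ℝ) - t ∈ I.toSet ∧ ∀ k, i < k → k < w → P k := by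
  induction m generalizing i with
  | succ m ih =>
    obtain ⟨k, hik, hk, hPk, hIk, hc⟩ := ha
    obtain ⟨k', hik', hk', -, hIk', hc'⟩ := hb
    obtain rfl : k = k' := by
      rcases lt_trichotomy k k' with h | h | h
      exacts [absurd hIk (hk' k hik h).2, h, absurd hIk' (hk k' hik' h).2]
    have hik_time : (ρ.time i : ℝ) ≤ ρ.time k := by exact_mod_cast ρ.mono hik.le
    obtain ⟨w, hkw, hQw, htw, hw⟩ := ih (hit.trans hik_time) hc hc'
    refine ⟨w, hik.trans hkw, hQw, htw, fun l hil hlw => ?_⟩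
    rcases lt_trichotomy l k with h | rfl | h
    exacts [(hk l hil h).1, hPk, hw l h hlw]
  | zero =>
    have hta' := hta.2 u rfl
    by_cases h1 : (ρ.time a : ℝ) - t ∈ I.toSet
    · exact ⟨a, ha.1, hQa, h1, ha.holds⟩
    by_cases h2 : (ρ.time b : ℝ) - t ∈ I.toSet
    · exact ⟨b, hb.1, hQb, h2, hb.holds⟩
    have h3 : (ρ.time a : ℝ) - t ≤ I.lower := by
      by_contra! h
      refine h1 ⟨by split_ifs <;> linarith, fun u' hu' => ?_⟩
      obtain rfl : u = u' := by rw [hu] at hu'; exact_mod_cast hu'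
      exact hta'
    have h4 : (u : ℝ) ≤ ρ.time b - t := by
      by_contra! h
      refine h2 ⟨htb.1, fun u' hu' => ?_⟩
      obtain rfl : u = u' := by rw [hu] at hu'; exact_mod_cast hu'
      split_ifs <;> linarith
    obtain ⟨w, haw, hwb, hQw, htw⟩ := exists_witness_of_early hu hlu hQa
      (fun k hak hkb => (hb.2 k (ha.1.trans_le hak) hkb).2) h3 h4
    exact ⟨w, ha.1.trans haw, hQw, htw, fun k hik hkw => hb.holds k hik (hkw.trans hwb)⟩

/-- A bounded window is the intersection of its two one-sided halves, provided both are tested on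
witnesses with the same number of isolated predecessors. -/
theorem until_iff_exists_chain {I : Interval} {u : ℕ} (hu : I.upper = u) (hlu : I.lower < u)
    (i : ρ.Dom) :
    (∃ j, i < j ∧ Q j ∧ (ρ.time j : ℝ) - ρ.time i ∈ I.toSet ∧ ∀ k, i < k → k < j → P k) ↔
      ∃ m ≤ u,
        (∃ j, Chain P Q m i j ∧ Q j ∧
          (ρ.time j : ℝ) - ρ.time i ∈ Interval.toSet ⟨0, u, true, I.rightClosed⟩) ∧
        ∃ j, Chain P Q m i j ∧ Q j ∧
          (ρ.time j : ℝ) - ρ.time i ∈ Interval.toSet ⟨I.lower, ⊤, I.leftClosed, true⟩ := by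
  constructor
  · rintro ⟨j, hij, hQ, ht, hP⟩
    obtain ⟨m, hm⟩ := exists_chain (Q := Q) hij hP
    have hle := hm.le_time hQ
    have h2 := ht.2 u hu
    refine ⟨m, ?_, ⟨j, hm, hQ, ?_, ?_⟩, ⟨j, hm, hQ, ht.1, by simp⟩⟩
    · have : (m : ℝ) ≤ u := by split_ifs at h2 <;> linarith
      exact_mod_cast this
    · have : (0 : ℝ) ≤ m := m.cast_nonneg
      simpa using by linarith
    · intro u' hu'
      obtain rfl : u = u' := ENat.natCast_inj.1 hu'
      exact h2
  · rintro ⟨m, -, ⟨a, ha, hQa, hta⟩, b, hb, hQb, htb⟩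
    exact Chain.exists_witness hu hlu le_rfl ha hb hQa hQb hta htb

end Chain

/-! ### From MITL to unilateral formulas -/

theorem closedBiExpressible_isolated {P Q : ∀ ρ : TimedWord A, ρ.Dom → Prop}
    (hP : ClosedBiExpressible P) (hQ : ClosedBiExpressible Q) :
    ClosedBiExpressible fun ρ => Isolated (P ρ) (Q ρ) := by
  refine (hQ.and ((hP.lift true).untl ((hQ.lift true).and
    (.constr_right 1 false))).freeze.not).congr fun ρ i => and_congr_right fun _ =>
      not_congr <| exists_congr fun j => and_congr_right fun hij => and_congr_left fun _ =>
        and_congr_right fun _ => ?_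
  have : (ρ.time i : ℝ) ≤ ρ.time j := by exact_mod_cast ρ.mono hij.le
  constructor
  · exact fun h => by simpa using h.2 1 rfl
  · refine fun h => ⟨by simpa using this, fun u hu => ?_⟩
    obtain rfl : 1 = u := ENat.natCast_inj.1 hu
    simpa using h

theorem biExpressible_chain {P Q : ∀ ρ : TimedWord A, ρ.Dom → Prop}
    (hP : ClosedBiExpressible P) (hQ : ClosedBiExpressible Q) {s : Bool} {C : ClockProp A}
    (hC : BiExpressible s C) (m : ℕ) :
    BiExpressible s fun ρ i t => ∃ j, Chain (P ρ) (Q ρ) m i j ∧ Q ρ j ∧ C ρ j t := by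
  have hI := closedBiExpressible_isolated hP hQ
  have hA := (hP.and hI.not).lift s
  induction m with
  | zero =>
    refine (hA.untl ((hQ.lift s).and hC)).congr fun ρ i t _ => exists_congr fun j => ?_
    simp only [Chain]
    tauto
  | succ m ih =>
    refine (hA.untl (((hP.and hI).lift s).and ih)).congr fun ρ i t _ => ?_
    simp only [Chain, untilProp]
    constructor
    · rintro ⟨k, hik, ⟨⟨hPk, hIk⟩, j, hc, hj⟩, hk⟩
      exact ⟨j, ⟨k, hik, hk, hPk, hIk, hc⟩, hj⟩
    · rintro ⟨j, ⟨k, hik, hk, hPk, hIk, hc⟩, hj⟩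
      exact ⟨k, hik, ⟨⟨hPk, hIk⟩, j, hc, hj⟩, hk⟩

theorem closedBiExpressible_timedUntil {P Q : ∀ ρ : TimedWord A, ρ.Dom → Prop}
    (hP : ClosedBiExpressible P) (hQ : ClosedBiExpressible Q) {I : Interval}
    (hI : ¬ I.IsPunctual) :
    ClosedBiExpressible fun ρ i => ∃ j, i < j ∧ Q ρ j ∧
      (ρ.time j : ℝ) - ρ.time i ∈ I.toSet ∧ ∀ k, i < k → k < j → P ρ k := by
  obtain hu | ⟨u, hu⟩ : I.upper = ⊤ ∨ ∃ u : ℕ, I.upper = u := by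
    cases h : I.upper with
    | top => exact Or.inl rfl
    | coe u => exact Or.inr ⟨u, rfl⟩
  · refine ((hP.lift false).untl ((hQ.lift false).and
      (.constr_left I.lower I.leftClosed))).freeze.congr fun ρ i => exists_congr fun j => ?_
    simp [Interval.toSet, hu, and_assoc]
  by_cases hlu : I.lower < u
  · exact (ClosedBiExpressible.exists_le (fun m =>
      (biExpressible_chain hP hQ (.constr_right u I.rightClosed) m).freeze.and
        (biExpressible_chain hP hQ (.constr_left I.lower I.leftClosed) m).freeze) u).congr
      fun ρ i => (until_iff_exists_chain hu hlu i).symm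
  · -- A non-punctual interval `⟨l, u⟩` with `u ≤ l` is empty.
    refine ClosedBiExpressible.bot.congr fun ρ i => ⟨False.elim, ?_⟩
    rintro ⟨j, -, -, ht, -⟩
    have h1 := ht.1
    have h2 := ht.2 u hu
    have hul : (u : ℝ) ≤ I.lower := by exact_mod_cast not_lt.1 hlu
    cases hl : I.leftClosed <;> cases hr : I.rightClosed <;> simp [hl, hr] at h1 h2 <;>
      try linarith
    refine hI ⟨hl, hr, ?_⟩
    have : (u : ℝ) = I.lower := by linarith
    rw [hu]
    exact_mod_cast this

theorem MTL.closedBiExpressible {φ : MTL A} (hφ : φ.IsMITL) :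
    ClosedBiExpressible fun ρ i => φ.Sat ρ i := by
  induction φ with
  | atom a => exact BiExpressible.freeze (s := true) ⟨.atom a, .natom a⟩
  | top => exact ClosedBiExpressible.bot.not.congr fun _ _ => by simp [MTL.Sat]
  | and φ ψ ihφ ihψ => exact (ihφ hφ.1).and (ihψ hφ.2)
  | not φ ih => exact (ih hφ).not
  | untl I φ ψ ihφ ihψ => exact closedBiExpressible_timedUntil (ihφ hφ.2.1) (ihψ hφ.2.2) hφ.1

/-! ### Non-degenerate intervals -/

/-- The interval contains an open interval between consecutive integers. -/
def Interval.Nondegenerate (I : Interval) : Prop := ∀ u : ℕ, I.upper = u → I.lower < u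

theorem Interval.mem_of_lt_of_lt {I : Interval} (hI : I.Nondegenerate) {x : ℝ}
    (h1 : (I.lower : ℝ) < x) (h2 : x < I.lower + 1) : x ∈ I.toSet := by
  refine ⟨by split_ifs <;> linarith, fun u hu => ?_⟩
  have : (I.lower : ℝ) + 1 ≤ u := by exact_mod_cast hI u hu
  split_ifs <;> linarith

theorem Interval.nondegenerate_of_mem {I : Interval} {x : ℝ} (hx : x ∈ I.toSet)
    (hint : ∀ n : ℕ, x ≠ n) : I.Nondegenerate := by
  intro u hu
  have h1 : (I.lower : ℝ) ≤ x := by have := hx.1; split_ifs at this <;> linarith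
  have h2 : x ≤ u := by have := hx.2 u hu; split_ifs at this <;> linarith
  have h3 := lt_of_le_of_ne h2 (hint u)
  exact_mod_cast h1.trans_lt h3

theorem Interval.mem_iff_of_lt_one {I : Interval} {x : ℝ} (h0 : 0 < x) (h1 : x < 1) :
    x ∈ I.toSet ↔ I.lower = 0 ∧ I.Nondegenerate := by
  constructor
  · intro hx
    have h2 : (I.lower : ℝ) ≤ x := by have := hx.1; split_ifs at this <;> linarith
    have h3 : I.lower < 1 := by exact_mod_cast h2.trans_lt h1
    refine ⟨by omega, nondegenerate_of_mem hx fun n hn => ?_⟩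
    rw [hn] at h0 h1
    have h4 : 0 < n := by exact_mod_cast h0
    have h5 : n < 1 := by exact_mod_cast h1
    omega
  · rintro ⟨h2, h3⟩
    exact mem_of_lt_of_lt h3 (by simpa [h2]) (by simpa [h2])

/-! ### Words with an irrational period -/

/-- The distance of consecutive events. -/
noncomputable def step : ℝ := √2 / 2

theorem half_lt_step : 1 / 2 < step := by
  have : 1 < √2 := Real.lt_sqrt_of_sq_lt (by norm_num)
  unfold step; linarith

theorem step_le : step ≤ 3 / 4 := by
  have : √2 ≤ 3 / 2 := Real.sqrt_le_iff.2 (by norm_num)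
  unfold step; linarith

theorem irrational_step : Irrational step := by
  simpa [step] using irrational_sqrt_two.div_natCast (m := 2) (by norm_num)

/-- The possible time stamps of the first event: rational numbers below the step. -/
abbrev Start : Type := Set.Icc (0 : ℚ) (1 / 2)

namespace Start

variable (q : Start)

theorem nonneg : (0 : ℝ) ≤ (q.1 : ℝ) := by exact_mod_cast q.2.1

theorem le_half : (q.1 : ℝ) ≤ 1 / 2 := by
  have : ((q.1 : ℚ) : ℝ) ≤ ((1 / 2 : ℚ) : ℝ) := by exact_mod_cast q.2.2
  simpa using this

theorem mul_step_sub_ne {m : ℕ} (hm : m ≠ 0) (n : ℕ) : (m : ℝ) * step - q.1 ≠ n := by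
  have h := (irrational_step.natCast_mul hm).sub_ratCast q.1
  exact h.ne_nat n

theorem step_sub_mem_iff (I : Interval) :
    step - q.1 ∈ I.toSet ↔ I.lower = 0 ∧ I.Nondegenerate := by
  have := half_lt_step
  have := step_le
  have := q.nonneg
  have := q.le_half
  exact Interval.mem_iff_of_lt_one (by linarith) (by linarith)

/-- As the step is less than one, a multiple of it falls between any two consecutive integers. -/
theorem exists_mul_step_sub_mem {I : Interval} (hI : I.Nondegenerate) :
    ∃ m : ℕ, m ≠ 0 ∧ m ≤ 2 * I.lower + 2 ∧ (m : ℝ) * step - q.1 ∈ I.toSet := by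
  have hs := half_lt_step
  have hs' := step_le
  have h0 := q.nonneg
  have h1 := q.le_half
  have hl : (0 : ℝ) ≤ I.lower := Nat.cast_nonneg _
  set y := (I.lower + (q.1 : ℝ)) / step with hy
  have hys : y * step = I.lower + q.1 := by
    rw [hy]; exact div_mul_cancel₀ _ (by linarith)
  have hy0 : 0 ≤ y := by positivity
  have h2 := Nat.lt_floor_add_one y
  have h3 := Nat.floor_le hy0
  refine ⟨⌊y⌋₊ + 1, by omega, ?_, Interval.mem_of_lt_of_lt hI ?_ ?_⟩
  · have h4 : y ≤ 2 * I.lower + 1 := by nlinarith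
    have : (⌊y⌋₊ : ℝ) ≤ (2 * I.lower + 1 : ℕ) := by push_cast; linarith
    have : ⌊y⌋₊ ≤ 2 * I.lower + 1 := by exact_mod_cast this
    omega
  · push_cast; nlinarith
  · push_cast; nlinarith

end Start

/-- Events at the positive multiples of the step and a first event at time `q`. -/
noncomputable def stepTime (q : Start) (i : ℕ) : ℝ := if i = 0 then q.1 else i * step

theorem stepTime_nonneg (q : Start) (i : ℕ) : 0 ≤ stepTime q i := by
  unfold stepTime
  split_ifs
  exacts [q.nonneg, mul_nonneg i.cast_nonneg (by linarith [half_lt_step])]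

/-- The offset of a position: its time stamp exceeds a multiple of the step only at the start. -/
def Start.offset (q : Start) (i : ℕ) : Start := if i = 0 then q else ⟨0, by norm_num⟩

theorem stepTime_sub (q : Start) {i j : ℕ} (hij : i < j) :
    stepTime q j - stepTime q i = ((j - i : ℕ) : ℝ) * step - (q.offset i).1 := by
  have hj : j ≠ 0 := by omega
  rw [Nat.cast_sub hij.le]
  by_cases hi : i = 0
  · simp [stepTime, Start.offset, hi, hj]
  · simp [stepTime, Start.offset, hi, hj]
    ring

theorem monotone_stepTime (q : Start) : Monotone (stepTime q) := by
  intro i j hij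
  rcases hij.eq_or_lt with rfl | hij
  · rfl
  have h := stepTime_sub q hij
  have h1 : (1 : ℝ) ≤ (j - i : ℕ) := by exact_mod_cast (by omega : 1 ≤ j - i)
  have := (q.offset i).le_half
  nlinarith [half_lt_step]

/-- The word of length `L` all of whose letters are `b`, with the time stamps `stepTime q`. -/
noncomputable def stepWord (b : A) (q : Start) (L : ℕ∞) : TimedWord A where
  length := L
  letter _ := b
  time i := ⟨stepTime q i.1, stepTime_nonneg q i.1⟩
  mono _ _ hij := monotone_stepTime q hij
  nonZeno := by
    rintro rfl T
    obtain ⟨n, hn⟩ := exists_nat_gt (2 * T : ℝ)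
    refine ⟨⟨n + 1, ENat.natCast_lt_top _⟩, show (T : ℝ) < stepTime q (n + 1) from ?_⟩
    simp only [stepTime, Nat.add_eq_zero_iff, one_ne_zero, and_false, if_false]
    push_cast
    nlinarith [T.coe_nonneg, half_lt_step]

theorem stepWord_time_sub (b : A) (q : Start) (L : ℕ∞) {i j : (stepWord b q L).Dom} (hij : i < j) :
    ((stepWord b q L).time j : ℝ) - (stepWord b q L).time i =
      ((j.1 - i.1 : ℕ) : ℝ) * step - (q.offset i.1).1 :=
  stepTime_sub q hij

theorem stepWord_mem_language_iff (b : A) (q : Start) (L : ℕ∞) (hL : 3 ≤ L) :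
    stepWord b q L ∈ (TPTL.twiceWithinOne b).language ↔ 2 * step - (q.1 : ℝ) ≤ 1 := by
  have hs := half_lt_step
  have hlt : ∀ n : ℕ, n < 3 → (n : ℕ∞) < L := fun n hn =>
    lt_of_lt_of_le (by exact_mod_cast hn) hL
  have hsub := fun {i j : (stepWord b q L).Dom} => stepWord_time_sub b q L (i := i) (j := j)
  constructor
  · rintro ⟨i, hi, j, hij, ⟨-, k, hjk, ⟨-, hk⟩, -⟩, -⟩
    have h1 := hk.2 1 rfl
    have hij' : i.1 < j.1 := hij
    have hjk' : j.1 < k.1 := hjk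
    simp only [Function.update_self, if_true] at h1
    rw [hsub (hij.trans hjk)] at h1
    have h2 : (2 : ℝ) ≤ (k.1 - i.1 : ℕ) := by exact_mod_cast (by omega : 2 ≤ k.1 - i.1)
    simp only [Start.offset, hi, if_true, Nat.cast_one, Nat.sub_zero] at h1 h2
    nlinarith
  · intro h
    have := q.le_half
    refine ⟨⟨0, hlt 0 (by omega)⟩, rfl, ⟨1, hlt 1 (by omega)⟩, ?_, ⟨rfl, ⟨2, hlt 2 (by omega)⟩,
      ?_, ⟨rfl, ?_⟩, fun _ _ _ => trivial⟩, fun _ _ _ => trivial⟩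
    · exact Subtype.mk_lt_mk.2 (by omega)
    · exact Subtype.mk_lt_mk.2 (by omega)
    · have h02 := stepTime_sub q (show 0 < 2 by omega)
      change stepTime q 2 - stepTime q 0 ∈ Interval.toSet _
      rw [h02]
      refine ⟨by simp [Start.offset]; linarith, fun u hu => ?_⟩
      obtain rfl : 1 = u := ENat.natCast_inj.1 hu
      simpa [Start.offset] using h

/-! ### Metric temporal logic on words with an irrational period -/

/-- On infinite words the truth value of an MTL formula depends neither on the position nor on the
time of the first event. -/
theorem exists_forall_sat_stepWord_top_iff (b : A) (φ : MTL A) :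
    ∃ v : Prop, ∀ (q : Start) (i : (stepWord b q ⊤).Dom), φ.Sat (stepWord b q ⊤) i ↔ v := by
  induction φ with
  | atom a => exact ⟨b = a, fun _ _ => Iff.rfl⟩
  | top => exact ⟨True, fun _ _ => Iff.rfl⟩
  | not φ ih =>
    obtain ⟨v, hv⟩ := ih
    exact ⟨¬ v, fun q i => not_congr (hv q i)⟩
  | and φ ψ ihφ ihψ =>
    obtain ⟨v, hv⟩ := ihφ
    obtain ⟨w, hw⟩ := ihψ
    exact ⟨v ∧ w, fun q i => and_congr (hv q i) (hw q i)⟩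
  | untl I φ ψ ihφ ihψ =>
    obtain ⟨v, hv⟩ := ihφ
    obtain ⟨w, hw⟩ := ihψ
    refine ⟨w ∧ I.Nondegenerate ∧ (v ∨ I.lower = 0), fun q i => ?_⟩
    simp only [MTL.Sat, hv, hw]
    constructor
    · rintro ⟨j, hij, hj, ht, hk⟩
      have hij' : i.1 < j.1 := hij
      rw [stepWord_time_sub b q ⊤ hij] at ht
      refine ⟨hj, Interval.nondegenerate_of_mem ht
        ((q.offset i.1).mul_step_sub_ne (by omega)), ?_⟩
      by_cases h : j.1 = i.1 + 1
      · rw [h, Nat.add_sub_cancel_left, Nat.cast_one, one_mul, Start.step_sub_mem_iff] at ht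
        exact Or.inr ht.1
      · exact Or.inl (hk ⟨i.1 + 1, ENat.natCast_lt_top _⟩ (Nat.lt_succ_self i.1)
          (show i.1 + 1 < j.1 by omega))
    · rintro ⟨hwv, hI, h⟩
      obtain ⟨m, hm, ht, hk⟩ : ∃ m : ℕ, m ≠ 0 ∧ (m : ℝ) * step - (q.offset i.1).1 ∈ I.toSet ∧
          (m = 1 ∨ v) := by
        rcases h with h | h
        · obtain ⟨m, hm, -, ht⟩ := (q.offset i.1).exists_mul_step_sub_mem hI
          exact ⟨m, hm, ht, Or.inr h⟩
        · exact ⟨1, one_ne_zero, by simpa [Start.step_sub_mem_iff] using ⟨h, hI⟩, Or.inl rfl⟩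
      have hlt : i < (⟨i.1 + m, ENat.natCast_lt_top _⟩ : (stepWord b q ⊤).Dom) :=
        show i.1 < i.1 + m by omega
      refine ⟨⟨i.1 + m, ENat.natCast_lt_top _⟩, hlt, hwv, ?_, fun k hik hkj => ?_⟩
      · rw [stepWord_time_sub b q ⊤ hlt]
        simpa using ht
      · have h1 : i.1 < k.1 := hik
        have h2 : k.1 < i.1 + m := hkj
        rcases hk with rfl | hk
        exacts [absurd h2 (by omega), hk]

/-- Until on finite words, in terms of the number `r` of remaining events, at a position with time
stamp off by `q`. -/
def remUntil (I : Interval) (P Q : ℕ → Prop) (q : Start) (r : ℕ) : Prop :=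
  ∃ r' < r, Q r' ∧ ((r - r' : ℕ) : ℝ) * step - q.1 ∈ I.toSet ∧ ∀ k, r' < k → k < r → P k

/-- Far from the end of the word, until is insensitive to the distance from the end and to the
offset. -/
theorem exists_remUntil_stable (I : Interval) {P Q : ℕ → Prop} {R : ℕ}
    (hP : ∀ r, R ≤ r → (P r ↔ P R)) (hQ : ∀ r, R ≤ r → (Q r ↔ Q R)) :
    ∃ (R' : ℕ) (v : Prop), ∀ r, R' ≤ r → ∀ q : Start, remUntil I P Q q r ↔ v := by
  have hs := half_lt_step
  by_cases hPR : P R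
  swap
  · -- Only the next position can be a witness.
    refine ⟨R + 2, Q R ∧ I.lower = 0 ∧ I.Nondegenerate, fun r hr q => ?_⟩
    rw [← q.step_sub_mem_iff, ← hQ (r - 1) (by omega)]
    have h1 : r - (r - 1) = 1 := by omega
    constructor
    · rintro ⟨r', hr', hQr, ht, hk⟩
      obtain rfl : r' = r - 1 := by
        by_contra hne
        exact hPR ((hP (r - 1) (by omega)).1 (hk _ (by omega) (by omega)))
      exact ⟨hQr, by simpa [h1] using ht⟩
    · rintro ⟨hQr, ht⟩
      exact ⟨r - 1, by omega, hQr, by simpa [h1] using ht, fun k _ _ => by omega⟩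
  have hPR' : ∀ r, R ≤ r → P r := fun r hr => (hP r hr).2 hPR
  by_cases hQR : Q R
  · refine ⟨R + (2 * I.lower + 2), I.Nondegenerate, fun r hr q => ?_⟩
    constructor
    · rintro ⟨r', hr', -, ht, -⟩
      exact Interval.nondegenerate_of_mem ht (q.mul_step_sub_ne (by omega))
    · intro hI
      obtain ⟨m, hm, hm', ht⟩ := q.exists_mul_step_sub_mem hI
      refine ⟨r - m, by omega, (hQ _ (by omega)).2 hQR, ?_, fun k hk _ => hPR' k (by omega)⟩
      rwa [show r - (r - m) = m by omega]
  -- All witnesses are near the end, hence beyond any bounded window.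
  have hnear : ∀ r', Q r' → r' < R := fun r' h => by
    by_contra! hr'
    exact hQR ((hQ r' hr').1 h)
  have hfar : ∀ (n r r' : ℕ) (q : Start), r' < R → R + (2 * n + 2) ≤ r →
      (n : ℝ) < ((r - r' : ℕ) : ℝ) * step - q.1 := by
    intro n r r' q h h'
    have h1 : (2 * n + 2 : ℝ) ≤ (r - r' : ℕ) := by
      exact_mod_cast (by omega : 2 * n + 2 ≤ r - r')
    have := q.le_half
    nlinarith
  cases hu : I.upper with
  | top =>
    refine ⟨R + (2 * I.lower + 2), ∃ r' < R, Q r' ∧ ∀ k, r' < k → k < R → P k,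
      fun r hr q => ?_⟩
    constructor
    · rintro ⟨r', hr', hQr, -, hk⟩
      exact ⟨r', hnear r' hQr, hQr, fun k h1 h2 => hk k h1 (by omega)⟩
    · rintro ⟨r', hr', hQr, hk⟩
      have := hfar I.lower r r' q hr' hr
      refine ⟨r', by omega, hQr, ⟨by split_ifs <;> linarith, by simp [hu]⟩, fun k h1 h2 => ?_⟩
      rcases lt_or_ge k R with h | h
      exacts [hk k h1 h, hPR' k h]
  | coe u =>
    refine ⟨R + (2 * u + 2), False, fun r hr q => ⟨?_, False.elim⟩⟩
    rintro ⟨r', hr', hQr, ht, -⟩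
    have h1 := hfar u r r' q (hnear r' hQr) hr
    have h2 := ht.2 u hu
    split_ifs at h2 <;> linarith

/-- On finite words the truth value of an MTL formula depends only on the number of remaining
events, and not even on that if it is large; the first position, whose offset matters, is covered
only in the latter case. -/
theorem exists_forall_sat_stepWord_iff (b : A) (φ : MTL A) :
    ∃ (R : ℕ) (T : ℕ → Prop), (∀ r, R ≤ r → (T r ↔ T R)) ∧
      ∀ (q : Start) (N : ℕ) (i : (stepWord b q N).Dom), i.1 ≠ 0 ∨ R ≤ N - 1 - i.1 →
        (φ.Sat (stepWord b q N) i ↔ T (N - 1 - i.1)) := by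
  induction φ with
  | atom a => exact ⟨0, fun _ => b = a, fun _ _ => Iff.rfl, fun _ _ _ _ => Iff.rfl⟩
  | top => exact ⟨0, fun _ => True, fun _ _ => Iff.rfl, fun _ _ _ _ => Iff.rfl⟩
  | not φ ih =>
    obtain ⟨R, T, hT, h⟩ := ih
    exact ⟨R, fun r => ¬ T r, fun r hr => not_congr (hT r hr),
      fun q N i hi => not_congr (h q N i hi)⟩
  | and φ ψ ihφ ihψ =>
    obtain ⟨R, T, hT, h⟩ := ihφ
    obtain ⟨R', T', hT', h'⟩ := ihψ
    refine ⟨max R R', fun r => T r ∧ T' r, fun r hr => ?_, fun q N i hi =>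
      and_congr (h q N i (hi.imp_right (le_of_max_le_left ·)))
        (h' q N i (hi.imp_right (le_of_max_le_right ·)))⟩
    simp only
    rw [hT r (le_of_max_le_left hr), hT' r (le_of_max_le_right hr), hT _ (le_max_left R R'),
      hT' _ (le_max_right R R')]
  | untl I φ ψ ihφ ihψ =>
    obtain ⟨R₁, T₁, hT₁, h₁⟩ := ihφ
    obtain ⟨R₂, T₂, hT₂, h₂⟩ := ihψ
    obtain ⟨R, v, hv⟩ := exists_remUntil_stable I (P := T₁) (Q := T₂) (R := max R₁ R₂)
      (fun r hr => (hT₁ r (le_of_max_le_left hr)).trans (hT₁ _ (le_max_left _ _)).symm)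
      (fun r hr => (hT₂ r (le_of_max_le_right hr)).trans (hT₂ _ (le_max_right _ _)).symm)
    have key : ∀ (q : Start) (N : ℕ) (i : (stepWord b q N).Dom),
        (MTL.untl I φ ψ).Sat (stepWord b q N) i ↔
          remUntil I T₁ T₂ (q.offset i.1) (N - 1 - i.1) := by
      intro q N i
      have hlt : ∀ j : (stepWord b q N).Dom, j.1 < N := fun j => Nat.cast_lt.1 j.2
      constructor
      · rintro ⟨j, hij, hj, ht, hk⟩
        have hij' : i.1 < j.1 := hij
        have := hlt j
        rw [stepWord_time_sub b q N hij] at ht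
        refine ⟨N - 1 - j.1, by omega, (h₂ q N j (Or.inl (by omega))).1 hj, ?_, fun k h1 h2 => ?_⟩
        · rwa [show N - 1 - i.1 - (N - 1 - j.1) = j.1 - i.1 by omega]
        · have hkN : ((N - 1 - k : ℕ) : ℕ∞) < N := Nat.cast_lt.2 (by omega)
          have := (h₁ q N ⟨N - 1 - k, hkN⟩ (Or.inl (by simp only; omega))).1
            (hk _ (show i.1 < N - 1 - k by omega) (show N - 1 - k < j.1 by omega))
          rwa [show N - 1 - (N - 1 - k) = k by omega] at this
      · rintro ⟨r', hr', hQ, ht, hk⟩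
        have hjN : ((N - 1 - r' : ℕ) : ℕ∞) < N := Nat.cast_lt.2 (by omega)
        have hij : i < (⟨N - 1 - r', hjN⟩ : (stepWord b q N).Dom) :=
          show i.1 < N - 1 - r' by omega
        refine ⟨⟨N - 1 - r', hjN⟩, hij, (h₂ q N _ (Or.inl (by simp only; omega))).2 ?_, ?_,
          fun k hik hkj => ?_⟩
        · rwa [show N - 1 - (N - 1 - r') = r' by omega]
        · rw [stepWord_time_sub b q N hij]
          rwa [show N - 1 - r' - i.1 = N - 1 - i.1 - r' by omega]
        · have h1 : i.1 < k.1 := hik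
          have h2 : k.1 < N - 1 - r' := hkj
          exact (h₁ q N k (Or.inl (by omega))).2 (hk _ (by omega) (by omega))
    refine ⟨R, remUntil I T₁ T₂ ⟨0, by norm_num⟩, fun r hr =>
      (hv r hr _).trans (hv R le_rfl _).symm, fun q N i hi => (key q N i).trans ?_⟩
    by_cases h0 : i.1 = 0
    · have hr := hi.resolve_left (not_not.2 h0)
      exact (hv _ hr _).trans (hv _ hr _).symm
    · simp [Start.offset, h0]

/-! ### The formula `x.F(b ∧ F(b ∧ x ≤ 1))` -/

/-- Two starting times on which `twiceWithinOne` differs. -/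
theorem not_forall_stepWord_mem_language_iff (b : A) (L : ℕ∞) (hL : 3 ≤ L) :
    ¬ ∀ q q' : Start, stepWord b q L ∈ (TPTL.twiceWithinOne b).language ↔
      stepWord b q' L ∈ (TPTL.twiceWithinOne b).language := by
  intro h
  have h1 := h ⟨0, by norm_num⟩ ⟨1 / 2, by norm_num⟩
  rw [stepWord_mem_language_iff _ _ _ hL, stepWord_mem_language_iff _ _ _ hL] at h1
  have hs := half_lt_step
  have h2 := h1.2 (by push_cast; linarith [step_le])
  push_cast at h2
  linarith

theorem not_exists_MTL_language_finite (b : A) :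
    ¬ ∃ φ : MTL A, ∀ ρ : TimedWord A, ρ.IsFinite →
      (ρ ∈ φ.language ↔ ρ ∈ (TPTL.twiceWithinOne b).language) := by
  rintro ⟨φ, hφ⟩
  obtain ⟨R, T, -, h⟩ := exists_forall_sat_stepWord_iff b φ
  refine not_forall_stepWord_mem_language_iff b (R + 3 : ℕ) (by exact_mod_cast Nat.le_add_left 3 R)
    fun q q' => ?_
  have key : ∀ q, stepWord b q (R + 3 : ℕ) ∈ (TPTL.twiceWithinOne b).language ↔ T (R + 2) := by
    intro q
    rw [← hφ (stepWord b q (R + 3 : ℕ)) (ENat.natCast_ne_top (R + 3))]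
    constructor
    · rintro ⟨i, hi, hs⟩
      have := (h q _ i (Or.inr (by omega))).1 hs
      rwa [show R + 3 - 1 - i.1 = R + 2 by omega] at this
    · intro hT
      exact ⟨⟨0, Nat.cast_lt.2 (by omega)⟩, rfl, (h q _ _ (Or.inr (by simp only; omega))).2 hT⟩
  exact (key q).trans (key q').symm

theorem not_exists_MTL_language_infinite (b : A) :
    ¬ ∃ φ : MTL A, ∀ ρ : TimedWord A, ρ.IsInfinite →
      (ρ ∈ φ.language ↔ ρ ∈ (TPTL.twiceWithinOne b).language) := by
  rintro ⟨φ, hφ⟩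
  obtain ⟨v, h⟩ := exists_forall_sat_stepWord_top_iff b φ
  refine not_forall_stepWord_mem_language_iff b ⊤ le_top fun q q' => ?_
  have key : ∀ q, stepWord b q ⊤ ∈ (TPTL.twiceWithinOne b).language ↔ v := by
    intro q
    rw [← hφ (stepWord b q ⊤) (Eq.refl (⊤ : ℕ∞))]
    exact ⟨fun ⟨i, _, hs⟩ => (h q i).1 hs,
      fun hv => ⟨⟨0, ENat.natCast_lt_top _⟩, rfl, (h q _).2 hv⟩⟩
  exact (key q).trans (key q').symm

theorem TPTL.isClosed_twiceWithinOne (b : A) : (twiceWithinOne b).IsClosed := by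
  refine Set.eq_empty_of_forall_notMem fun c hc => hc.2 (Subsingleton.elim _ _)

theorem TPTL.isUnilateral_twiceWithinOne (b : A) : (twiceWithinOne b).IsUnilateral := by
  intro ψ hψ
  refine Or.inl ?_
  simp only [twiceWithinOne, eventually, subformulas, Set.mem_insert_iff, Set.mem_union,
    Set.mem_singleton_iff] at hψ
  rcases hψ with rfl | rfl | rfl | rfl | rfl | rfl | rfl | rfl | rfl | rfl <;>
    simp [IsTypeLE, openConstraints, Interval.IsRightSided]

end TimedLogic

open TimedLogic in
theorem mainTheorem3 {A : Type*} [Finite A] :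
    (∀ φ : MTL A, φ.IsMITL →
      ∃ ψ : TPTL A (Fin 1), ψ.IsClosed ∧ ψ.IsUnilateral ∧
        ∀ (ρ : TimedWord A) (i : ρ.Dom) (ν : Fin 1 → ℝ≥0), ψ.Sat ρ i ν ↔ φ.Sat ρ i) ∧
    (∀ b : A,
      (TPTL.twiceWithinOne b).IsClosed ∧ (TPTL.twiceWithinOne b).IsUnilateral ∧
      (¬ ∃ φ : MTL A, ∀ ρ : TimedWord A, ρ.IsFinite →
        (ρ ∈ φ.language ↔ ρ ∈ (TPTL.twiceWithinOne b).language)) ∧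
      (¬ ∃ φ : MTL A, ∀ ρ : TimedWord A, ρ.IsInfinite →
        (ρ ∈ φ.language ↔ ρ ∈ (TPTL.twiceWithinOne b).language))) := by
  refine ⟨fun φ hφ => (MTL.closedBiExpressible hφ).1, fun b => ⟨TPTL.isClosed_twiceWithinOne b,
    TPTL.isUnilateral_twiceWithinOne b, not_exists_MTL_language_finite b,
    not_exists_MTL_language_infinite b⟩⟩
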